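/- Let $G$ be a finite simple graph and $k\ge 1$ an integer. Two distinct proper $k$-colourings $V(G)\to\{1,\dots,k\}$ are called adjacent if they differ on exactly one vertex; a cluster is a connected component of the resulting graph on the set of all proper $k$-colourings of $G$. A vertex $v$ is frozen in a proper $k$-colouring $\tau$ if $\sigma(v)=\tau(v)$ for every $\sigma$ in the same cluster as $\tau$. Proposition. For all integers $g\ge 3$ and $d\ge 3$ there are constants $c,C>0$ (depending only on $g$ and $d$), an integer $N$, and, for every $n\ge N$ with $dn$ even, a $d$-regular graph $G_n$ on $n$ vertices of girth at least $g$, such that, if $\boldsymbol\sigma_n$ is a uniformly random proper $(d+1)$-colouring of $G_n$ and $X_n$ is the number of vertices of $G_n$ that are frozen in $\boldsymbol\sigma_n$, then \[ \Pr\big(c\,n\le X_n\le C\,n\big)\longrightarrow 1 \] as $n\to\infty$ along the integers $n$ with $dn$ even. -/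

import Mathlib

/-- The distance-`t` `k`-colouring graph: its vertices are the proper `k`-colourings of `G`, and
two distinct colourings are adjacent if their Hamming distance is at most `t`. -/
def colouringGraph {V : Type*} [Fintype V] (G : SimpleGraph V) (k t : ℕ) :
    SimpleGraph (G.Coloring (Fin k)) where
  Adj τ σ := τ ≠ σ ∧ hammingDist (fun v => τ v) (fun v => σ v) ≤ t
  symm := ⟨fun _ _ h => ⟨h.1.symm, by rw [hammingDist_comm]; exact h.2⟩⟩
  loopless := ⟨fun _ h => h.1 rfl⟩

/-- The vertex `v` is `t`-frozen in the proper `k`-colouring `τ`: every colouring in the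
same `t`-cluster (connected component of the distance-`t` colouring graph) gives `v` the
same colour as `τ`. -/
def IsFrozen {V : Type*} [Fintype V] {G : SimpleGraph V} {k : ℕ} (t : ℕ)
    (τ : G.Coloring (Fin k)) (v : V) : Prop :=
  ∀ σ : G.Coloring (Fin k), (colouringGraph G k t).Reachable τ σ → τ v = σ v

/-- The number of frozen (that is, `1`-frozen) vertices in `τ`. -/
noncomputable def numFrozen {V : Type*} [Fintype V] {G : SimpleGraph V} {k : ℕ}
    (τ : G.Coloring (Fin k)) : ℕ :=
  {v : V | IsFrozen 1 τ v}.ncard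

/-- All sets of colourings are events. -/
instance colouringMeasurableSpace {V : Type*} (G : SimpleGraph V) (k : ℕ) :
    MeasurableSpace (G.Coloring (Fin k)) := ⊤

/-- The law of a uniformly random proper `k`-colouring of `G`. -/
noncomputable def uniformColouring {V : Type*} (G : SimpleGraph V) (k : ℕ) :
    MeasureTheory.Measure (G.Coloring (Fin k)) :=
  ProbabilityTheory.uniformOn Set.univ

open Classical in
/-- `G` is `d`-regular (Mathlib's notion, with classical decidability of adjacency). -/
def IsRegularGraph {V : Type*} [Fintype V] (G : SimpleGraph V) (d : ℕ) : Prop :=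
  G.IsRegularOfDegree d

/-! The graphs need not be connected, so a disjoint union of many copies of one fixed graph `H`,
plus a bounded remainder, suffices. Take for `H` a finite lift of the complete graph on `d + 1`
vertices without short circuits (`completeLift_noShortReturn`). Colouring it by the base vertex,
every vertex sees all `d` other colours; no vertex can then be recoloured alone, so the whole copy
is frozen (`isFrozen_of_rainbow`).

A uniform colouring of a disjoint union is a product, so each copy carries this colouring
independently with a fixed positive probability. An exponential Markov bound
(`card_few_coordinates_le`) gives linearly many such copies except with exponentially small
probability. The upper bound is trivial with `C = 1`.

Only divisibility remains: when `n` is not a multiple of the order of `H`, the leftover vertices are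
spliced into deleted edges of a bounded number of copies, keeping degree, girth and colourability
(`exists_iso_sum_disjointCopies`). -/

/-! ### Short closed walks, girth and regularity. -/

/-- `G` has no closed non-backtracking walk of positive length less than `g`. The closing step
is subject to the non-backtracking condition too: the walk is given as a periodic sequence. -/
def NoShortCircuit {V : Type*} (G : SimpleGraph V) (g : ℕ) : Prop :=
  ∀ (m : ℕ) (x : ℕ → V), 1 ≤ m → m < g → (∀ k, G.Adj (x k) (x (k + 1))) →
    (∀ k, x k ≠ x (k + 2)) → (∀ k, x (k + m) = x k) → False

/-- `G` has no closed walk of positive length at most `L` that is non-backtracking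
except possibly at its base point. -/
def NoShortReturn {V : Type*} (G : SimpleGraph V) (L : ℕ) : Prop :=
  ∀ (m : ℕ) (x : ℕ → V), 1 ≤ m → m ≤ L → (∀ k < m, G.Adj (x k) (x (k + 1))) →
    (∀ k, k + 2 ≤ m → x k ≠ x (k + 2)) → x m = x 0 → False

theorem NoShortReturn.noShortCircuit {V : Type*} {G : SimpleGraph V} {g : ℕ}
    (h : NoShortReturn G g) : NoShortCircuit G g := fun m x h1 hm hadj hnb hper =>
  h m x h1 hm.le (fun k _ => hadj k) (fun k _ => hnb k) (by simpa using hper 0)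

theorem NoShortCircuit.le_egirth {V : Type*} {G : SimpleGraph V} {g : ℕ}
    (h : NoShortCircuit G g) : (g : ℕ∞) ≤ G.egirth := by
  rw [SimpleGraph.le_egirth]
  intro a w hw
  by_contra hlt
  have hlt : w.length < g := by
    rw [not_le] at hlt
    exact_mod_cast hlt
  have h3 := hw.three_le_length
  set m := w.length with hm
  have hmod : ∀ k, k % m < m := fun k => Nat.mod_lt _ (by omega)
  refine h m (fun k => w.getVert (k % m)) (by omega) hlt (fun k => ?_) (fun k => ?_)
    (fun k => by simp)
  · have hk := hmod k
    have hadj := w.adj_getVert_succ (i := k % m) hk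
    by_cases hc : k % m + 1 = m
    · have h0 : (k + 1) % m = 0 := by
        rw [Nat.add_mod, Nat.mod_eq_of_lt (by omega : 1 < m), hc, Nat.mod_self]
      rw [hc, hm, SimpleGraph.Walk.getVert_length] at hadj
      simpa [h0, SimpleGraph.Walk.getVert_zero] using hadj
    · have h0 : (k + 1) % m = k % m + 1 := by
        rw [Nat.add_mod, Nat.mod_eq_of_lt (by omega : 1 < m), Nat.mod_eq_of_lt (by omega)]
      simpa [h0] using hadj
  · intro heq
    have hk := hmod k
    have hk2 := hmod (k + 2)
    have hinj := hw.getVert_injOn' (x₁ := k % m) (by simp; omega) (x₂ := (k + 2) % m)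
      (by simp; omega) heq
    -- Backtracking, even across the closing point, would force `m ∣ 2`, but a cycle has length at
    -- least 3.
    have h2 : k ≡ k + 2 [MOD m] := hinj
    have : m ∣ 2 := by simpa using (Nat.modEq_iff_dvd' (by omega)).1 h2
    have := Nat.le_of_dvd (by omega) this
    omega

theorem NoShortCircuit.of_iso {V W : Type*} {G : SimpleGraph V} {H : SimpleGraph W} {g : ℕ}
    (φ : G ≃g H) (h : NoShortCircuit H g) : NoShortCircuit G g := fun m x h1 hm hadj hnb hper =>
  h m (fun k => φ (x k)) h1 hm (fun k => φ.map_adj_iff.2 (hadj k))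
    (fun k he => hnb k (φ.injective he)) (fun k => by rw [hper])

theorem NoShortCircuit.sum {V W : Type*} {G : SimpleGraph V} {H : SimpleGraph W} {g : ℕ}
    (hG : NoShortCircuit G g) (hH : NoShortCircuit H g) : NoShortCircuit (G ⊕g H) g := by
  intro m x h1 hm hadj hnb hper
  rcases h0 : x 0 with v | w
  · have key : ∀ k, ∃ v, x k = .inl v := by
      intro k
      induction k with
      | zero => exact ⟨v, h0⟩
      | succ k ih =>
        obtain ⟨u, hu⟩ := ih
        have := hadj k
        rw [hu] at this
        rcases hx : x (k + 1) with y | y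
        · exact ⟨y, rfl⟩
        · simp [hx] at this
    choose y hy using key
    simp only [hy] at hadj hnb hper
    exact hG m y h1 hm (fun k => by simpa using hadj k)
      (fun k he => hnb k (congrArg _ he)) (fun k => Sum.inl_injective (hper k))
  · have key : ∀ k, ∃ v, x k = .inr v := by
      intro k
      induction k with
      | zero => exact ⟨w, h0⟩
      | succ k ih =>
        obtain ⟨u, hu⟩ := ih
        have := hadj k
        rw [hu] at this
        rcases hx : x (k + 1) with y | y
        · simp [hx] at this
        · exact ⟨y, rfl⟩
    choose y hy using key
    simp only [hy] at hadj hnb hper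
    exact hH m y h1 hm (fun k => by simpa using hadj k)
      (fun k he => hnb k (congrArg _ he)) (fun k => Sum.inr_injective (hper k))

/-- The disjoint union of copies of `H` indexed by `ι`. -/
def disjointCopies (ι : Type*) {V : Type*} (H : SimpleGraph V) : SimpleGraph (ι × V) where
  Adj a b := a.1 = b.1 ∧ H.Adj a.2 b.2
  symm := ⟨fun _ _ h => ⟨h.1.symm, h.2.symm⟩⟩
  loopless := ⟨fun _ h => H.loopless.irrefl _ h.2⟩

theorem NoShortCircuit.disjointCopies {ι V : Type*} {H : SimpleGraph V} {g : ℕ}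
    (h : NoShortCircuit H g) : NoShortCircuit (disjointCopies ι H) g := by
  intro m x h1 hm hadj hnb hper
  have key : ∀ k, (x k).1 = (x 0).1 := by
    intro k
    induction k with
    | zero => rfl
    | succ k ih => rw [← ih]; exact (hadj k).1.symm
  exact h m (fun k => (x k).2) h1 hm (fun k => (hadj k).2)
    (fun k he => hnb k (Prod.ext ((key k).trans (key (k + 2)).symm) he)) (fun k => by rw [hper])

/-- `G` is `d`-regular, in terms of cardinalities of neighbour sets. -/
def NeighborCard {V : Type*} (G : SimpleGraph V) (d : ℕ) : Prop :=
  ∀ v, (G.neighborSet v).ncard = d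

theorem NeighborCard.isRegularGraph {V : Type*} [Fintype V] {G : SimpleGraph V} {d : ℕ}
    (h : NeighborCard G d) : IsRegularGraph G d := by
  intro v
  classical
  rw [← h v, ← SimpleGraph.card_neighborSet_eq_degree, ← Nat.card_coe_set_eq,
    Nat.card_eq_fintype_card]

theorem NeighborCard.of_iso {V W : Type*} {G : SimpleGraph V} {H : SimpleGraph W} {d : ℕ}
    (φ : G ≃g H) (h : NeighborCard H d) : NeighborCard G d := by
  intro v
  rw [← h (φ v), ← Nat.card_coe_set_eq, ← Nat.card_coe_set_eq]
  exact Nat.card_congr (φ.mapNeighborSet v)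

theorem NeighborCard.sum {V W : Type*} {G : SimpleGraph V} {H : SimpleGraph W} {d : ℕ}
    (hG : NeighborCard G d) (hH : NeighborCard H d) : NeighborCard (G ⊕g H) d := by
  rintro (v | w)
  · rw [SimpleGraph.neighborSet_sum_inl, Set.ncard_image_of_injective _ Sum.inl_injective, hG]
  · rw [SimpleGraph.neighborSet_sum_inr, Set.ncard_image_of_injective _ Sum.inr_injective, hH]

theorem NeighborCard.disjointCopies {ι V : Type*} {H : SimpleGraph V} {d : ℕ}
    (h : NeighborCard H d) : NeighborCard (disjointCopies ι H) d := by
  rintro ⟨i, v⟩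
  rw [← h v, ← Set.ncard_image_of_injective (H.neighborSet v) (Prod.mk_right_injective i)]
  refine congrArg Set.ncard (Set.ext ?_)
  rintro ⟨j, w⟩
  constructor
  · rintro ⟨hij, hw⟩
    exact ⟨w, hw, Prod.ext hij rfl⟩
  · rintro ⟨w', hw, he⟩
    cases he
    exact ⟨rfl, hw⟩

/-! ### A finite lift of the complete graph with large girth. -/

/-- Words of length at most `L` over `E` without two equal consecutive letters. -/
abbrev ReducedWord (E : Type*) (L : ℕ) : Type _ :=
  {l : List E // l.length ≤ L ∧ l.IsChain (· ≠ ·)}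

instance (E : Type*) [Finite E] (L : ℕ) : Finite (ReducedWord E L) :=
  ((List.finite_length_le E L).subset fun _ h => h.1).to_subtype

open Classical in
/-- Multiply a word by the involution `e`, leaving it unchanged if it would get too long. -/
noncomputable def toggleLetter {E : Type*} (L : ℕ) (e : E) (l : List E) : List E :=
  if l.head? = some e then l.tail else if l.length < L then e :: l else l

theorem toggleLetter_mem {E : Type*} {L : ℕ} (e : E) {l : List E}
    (h : l.length ≤ L ∧ l.IsChain (· ≠ ·)) :
    (toggleLetter L e l).length ≤ L ∧ (toggleLetter L e l).IsChain (· ≠ ·) := by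
  unfold toggleLetter
  split_ifs with h1 h2
  · exact ⟨by simp; omega, h.2.tail⟩
  · refine ⟨by simp; omega, ?_⟩
    rw [List.isChain_cons]
    refine ⟨fun y hy he => h1 ?_, h.2⟩
    subst he
    exact hy
  · exact h

/-- After deleting a leading `e`, reducedness ensures that the tail does not start with `e` again,
so the second toggle restores it. Words of full length not starting with `e` are fixed points. -/
theorem toggleLetter_toggleLetter {E : Type*} {L : ℕ} (e : E) {l : List E}
    (h : l.length ≤ L ∧ l.IsChain (· ≠ ·)) : toggleLetter L e (toggleLetter L e l) = l := by
  by_cases h1 : l.head? = some e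
  · rcases l with _ | ⟨a, l⟩
    · simp at h1
    · obtain rfl : a = e := by simpa using h1
      have h2 : ¬ l.head? = some a := fun h' => (List.isChain_cons.1 h.2).1 a h' rfl
      have h3 : l.length < L := by simpa using h.1
      simp [toggleLetter, h2, h3]
  · by_cases h2 : l.length < L
    · simp [toggleLetter, h1, h2]
    · simp [toggleLetter, h1, h2]

/-- The permutation of reduced words given by the involution `e`. -/
noncomputable def togglePerm {E : Type*} (L : ℕ) (e : E) : Equiv.Perm (ReducedWord E L) :=
  Function.Involutive.toPerm (fun l => ⟨toggleLetter L e l.1, toggleLetter_mem e l.2⟩)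
    fun l => Subtype.ext (toggleLetter_toggleLetter e l.2)

theorem togglePerm_apply_val {E : Type*} (L : ℕ) (e : E) (l : ReducedWord E L) :
    (togglePerm L e l).1 = toggleLetter L e l.1 := rfl

theorem togglePerm_mul_self {E : Type*} (L : ℕ) (e : E) :
    togglePerm L e * togglePerm L e = 1 :=
  Equiv.ext fun l => Subtype.ext (toggleLetter_toggleLetter e l.2)

/-- The vertices of the lift of the complete graph on `κ`. -/
abbrev LiftVertex (κ : Type*) (L : ℕ) : Type _ := κ × Equiv.Perm (ReducedWord (Sym2 κ) L)

/-- A lift of the complete graph on `κ` without circuits of length at most `L`. -/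
noncomputable def completeLift (κ : Type*) (L : ℕ) : SimpleGraph (LiftVertex κ L) where
  Adj a b := a.1 ≠ b.1 ∧ b.2 = togglePerm L s(a.1, b.1) * a.2
  symm := ⟨fun a b h => ⟨h.1.symm, by
    rw [h.2, Sym2.eq_swap, ← mul_assoc, togglePerm_mul_self, one_mul]⟩⟩
  loopless := ⟨fun _ h => h.1 rfl⟩

/-- Along a non-backtracking walk consecutive edge labels differ, so up to length `L` each toggle
prepends a letter. A word that starts out empty has length `m` after `m` steps, so the walk cannot
have closed. -/
theorem completeLift_noShortReturn (κ : Type*) (L : ℕ) : NoShortReturn (completeLift κ L) L := by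
  intro m x h1 hm hadj hnb hcl
  -- The point to track is the one that the initial permutation sends to the empty word.
  set base : ReducedWord (Sym2 κ) L := (x 0).2⁻¹ ⟨[], by simp⟩ with hbase
  have hlen : ∀ k, k + 1 ≤ m → (((x (k + 1)).2 base).1.length = k + 1 ∧
      ((x (k + 1)).2 base).1.head? = some s((x k).1, (x (k + 1)).1)) := by
    intro k
    induction k with
    | zero =>
      intro hk
      have h0 : (x 0).2 base = ⟨[], by simp⟩ := by simp [hbase]
      rw [(hadj 0 (by omega)).2, Equiv.Perm.mul_apply, togglePerm_apply_val, h0]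
      have : 0 < L := by omega
      simp [toggleLetter, this]
    | succ k ih =>
      intro hk
      obtain ⟨ih1, ih2⟩ := ih (by omega)
      have ha := hadj k (by omega)
      have hb := hadj (k + 1) (by omega)
      have hne : ¬ ((x (k + 1)).2 base).1.head? = some s((x (k + 1)).1, (x (k + 1 + 1)).1) := by
        rw [ih2]
        intro he
        have he := Option.some.inj he
        -- Equal consecutive labels give equal base vertices two steps apart, and the two toggles
        -- cancel, so the walk would backtrack.
        rw [Sym2.eq_swap, Sym2.congr_right] at he
        refine hnb k (by omega) (Prod.ext he ?_)
        show (x k).2 = (x (k + 1 + 1)).2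
        rw [hb.2, ha.2, ← he, Sym2.eq_swap, ← mul_assoc, togglePerm_mul_self, one_mul]
      rw [hb.2, Equiv.Perm.mul_apply, togglePerm_apply_val]
      have hL : ((x (k + 1)).2 base).1.length < L := by omega
      simp only [toggleLetter, hne, hL, if_true, if_false]
      exact ⟨by simp [ih1], by simp⟩
  obtain ⟨k, rfl⟩ : ∃ k, m = k + 1 := ⟨m - 1, by omega⟩
  have := (hlen k le_rfl).1
  rw [hcl] at this
  simp [hbase] at this

theorem completeLift_exists_neighbor {κ : Type*} {L : ℕ} (v : LiftVertex κ L) {c : κ}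
    (hc : v.1 ≠ c) : ∃ w, (completeLift κ L).Adj v w ∧ w.1 = c :=
  ⟨(c, togglePerm L s(v.1, c) * v.2), ⟨hc, rfl⟩, rfl⟩

theorem completeLift_neighborCard (d L : ℕ) :
    NeighborCard (completeLift (Fin (d + 1)) L) d := by
  intro v
  have : (completeLift (Fin (d + 1)) L).neighborSet v =
      (fun c => (c, togglePerm L s(v.1, c) * v.2)) '' {c | c ≠ v.1} := by
    ext ⟨c, π⟩
    constructor
    · rintro ⟨h1, h2⟩
      exact ⟨c, h1.symm, Prod.ext rfl h2.symm⟩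
    · rintro ⟨c', h1, h2⟩
      cases h2
      exact ⟨h1.symm, rfl⟩
  rw [this, Set.ncard_image_of_injective _ (fun a b h => (Prod.ext_iff.1 h).1)]
  have h2 : {c | c ≠ v.1} = ({v.1} : Set (Fin (d + 1)))ᶜ := rfl
  rw [h2, Set.ncard_compl, Set.ncard_singleton]
  simp

/-- The colouring of the lift by the base point of each vertex. -/
noncomputable def baseColoring (κ : Type*) (L : ℕ) : (completeLift κ L).Coloring κ :=
  SimpleGraph.Coloring.mk Prod.fst fun h => h.1

/-! ### Splicing extra vertices into copies of `H`. -/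

/-- Delete the edge with ends `p false` and `p true` in each of the copies of `H` indexed by `M`,
and join each loose end `(i, p b)` to the new vertex `f (i, b)`. -/
def spliceGraph {V M Z : Type*} (H : SimpleGraph V) (p : Bool → V) (f : M × Bool → Z) :
    SimpleGraph ((M × V) ⊕ Z) where
  Adj
    | .inl a, .inl b => a.1 = b.1 ∧ H.Adj a.2 b.2 ∧ s(a.2, b.2) ≠ s(p false, p true)
    | .inl a, .inr z => ∃ b, a.2 = p b ∧ f (a.1, b) = z
    | .inr z, .inl a => ∃ b, a.2 = p b ∧ f (a.1, b) = z
    | .inr _, .inr _ => False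
  symm := ⟨by
    rintro (a | z) (b | w) h
    · exact ⟨h.1.symm, h.2.1.symm, by rw [Sym2.eq_swap]; exact h.2.2⟩
    · exact h
    · exact h
    · exact h⟩
  loopless := ⟨by
    rintro (a | z) h
    · exact H.loopless.irrefl _ h.2.1
    · exact h⟩

section Splice

variable {V M Z : Type*} {H : SimpleGraph V} {p : Bool → V} {f : M × Bool → Z}

theorem spliceGraph_adj_inl_inl {a b : M × V} : (spliceGraph H p f).Adj (.inl a) (.inl b) ↔
    a.1 = b.1 ∧ H.Adj a.2 b.2 ∧ s(a.2, b.2) ≠ s(p false, p true) := Iff.rfl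

theorem spliceGraph_adj_inl_inr {a : M × V} {z : Z} :
    (spliceGraph H p f).Adj (.inl a) (.inr z) ↔ ∃ b, a.2 = p b ∧ f (a.1, b) = z := Iff.rfl

theorem spliceGraph_adj_inr_inl {a : M × V} {z : Z} :
    (spliceGraph H p f).Adj (.inr z) (.inl a) ↔ ∃ b, a.2 = p b ∧ f (a.1, b) = z := Iff.rfl

theorem spliceGraph_not_adj_inr_inr {z w : Z} :
    ¬ (spliceGraph H p f).Adj (.inr z) (.inr w) := id

theorem sym2_bool_apply_eq (p : Bool → V) {b b' : Bool} (h : b ≠ b') :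
    s(p b, p b') = s(p false, p true) := by
  cases b <;> cases b'
  · exact absurd rfl h
  · rfl
  · exact Sym2.eq_swap
  · exact absurd rfl h

/-- Between two successive visits to new vertices the circuit stays in one copy of `H` and joins two
loose ends. It is already closed in `H`, or becomes so by adding the deleted edge. Since
backtracking may occur at the base point, `NoShortReturn` is the hypothesis needed. -/
theorem spliceGraph_no_circuit_through_inr {g : ℕ} (hadjp : H.Adj (p false) (p true))
    (hH : NoShortReturn H g) (m : ℕ) (x : ℕ → (M × V) ⊕ Z) (h1 : 1 ≤ m) (hm : m < g)
    (hadj : ∀ k, (spliceGraph H p f).Adj (x k) (x (k + 1))) (hnb : ∀ k, x k ≠ x (k + 2))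
    (hper : ∀ k, x (k + m) = x k) (z : Z) (hz : x 0 = .inr z) : False := by
  classical
  have hex : ∃ k, 1 ≤ k ∧ ∃ w, x k = .inr w := ⟨m, h1, z, by rw [← hz, ← hper 0, zero_add]⟩
  obtain ⟨a, ha⟩ : ∃ a, x 1 = .inl a := by
    rcases hx : x 1 with a | w
    · exact ⟨a, rfl⟩
    · have := hadj 0
      rw [hz, zero_add, hx] at this
      exact (spliceGraph_not_adj_inr_inr this).elim
  obtain ⟨k, ⟨hk1, w, hw⟩, hkm, hmin⟩ : ∃ k, (1 ≤ k ∧ ∃ w, x k = .inr w) ∧ k ≤ m ∧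
      ∀ j < k, ¬ (1 ≤ j ∧ ∃ w, x j = .inr w) :=
    ⟨Nat.find hex, Nat.find_spec hex,
      Nat.find_min' hex ⟨h1, z, by rw [← hz, ← hper 0, zero_add]⟩, fun j hj => Nat.find_min hex hj⟩
  have hk2 : k ≠ 1 := by
    rintro rfl
    rw [ha] at hw
    cases hw
  obtain ⟨n, rfl⟩ : ∃ n, k = n + 2 := ⟨k - 2, by omega⟩
  have hy : ∀ j, ∃ b, j ≤ n → x (j + 1) = .inl b := by
    intro j
    rcases hx : x (j + 1) with b | w
    · exact ⟨b, fun _ => rfl⟩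
    · exact ⟨a, fun hj => absurd ⟨by omega, w, hx⟩ (hmin (j + 1) (by omega))⟩
  choose y hy using hy
  have hyadj : ∀ j < n, (y j).1 = (y (j + 1)).1 ∧ H.Adj (y j).2 (y (j + 1)).2 ∧
      s((y j).2, (y (j + 1)).2) ≠ s(p false, p true) := by
    intro j hj
    have := hadj (j + 1)
    rwa [hy j (by omega), hy (j + 1) (by omega), spliceGraph_adj_inl_inl] at this
  have hfst : ∀ j ≤ n, (y j).1 = (y 0).1 := by
    intro j
    induction j with
    | zero => simp
    | succ j ih => intro hj; rw [← ih (by omega), (hyadj j (by omega)).1]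
  have hynb : ∀ j, j + 2 ≤ n → (y j).2 ≠ (y (j + 2)).2 := by
    intro j hj he
    refine hnb (j + 1) ?_
    rw [hy j (by omega), show j + 1 + 2 = j + 2 + 1 by omega, hy (j + 2) hj]
    exact congrArg _ (Prod.ext ((hfst j (by omega)).trans (hfst (j + 2) hj).symm) he)
  obtain ⟨b, hb1, hb2⟩ : ∃ b, (y 0).2 = p b ∧ f ((y 0).1, b) = z := by
    have := hadj 0
    rwa [hz, hy 0 (by omega), spliceGraph_adj_inr_inl] at this
  obtain ⟨b', hb1', hb2'⟩ : ∃ b, (y n).2 = p b ∧ f ((y n).1, b) = w := by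
    have := hadj (n + 1)
    rwa [hw, hy n le_rfl, spliceGraph_adj_inl_inr] at this
  by_cases hbb : b = b'
  · subst hbb
    -- If `n = 0`, the circuit enters and leaves the copy by the same edge and so backtracks.
    rcases Nat.eq_zero_or_pos n with rfl | hn
    · refine hnb 0 ?_
      rw [hz, hw, ← hb2, ← hb2']
    · exact hH n (fun j => (y j).2) hn (by omega) (fun j hj => (hyadj j hj).2.1) hynb
        (hb1'.trans hb1.symm)
  · have hadjb : H.Adj (p b') (p b) := by
      have h : s(p b', p b) = s(p false, p true) := sym2_bool_apply_eq p (Ne.symm hbb)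
      rw [← SimpleGraph.mem_edgeSet, h]
      exact hadjp
    refine hH (n + 1) (fun j => if j ≤ n then (y j).2 else (y 0).2) (by omega) (by omega)
      (fun j hj => ?_) (fun j hj => ?_) (by simp)
    · by_cases hjn : j = n
      · subst hjn
        simpa [hb1, hb1'] using hadjb
      · have h1 : j ≤ n := by omega
        have h2 : j + 1 ≤ n := by omega
        simpa only [h1, h2, if_true] using (hyadj j h2).2.1
    -- The closing step along the deleted edge is the only new place to backtrack; that would mean
    -- the preceding step had used the deleted edge.
    · by_cases hjn : j + 1 = n
      · subst hjn
        have h1 : ¬ j + 2 ≤ j + 1 := by omega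
        simp only [Nat.le_succ, h1, if_true, if_false]
        intro he
        refine (hyadj j (by omega)).2.2 ?_
        rw [he, hb1, hb1']
        exact sym2_bool_apply_eq p hbb
      · have h1 : j ≤ n := by omega
        have h2 : j + 2 ≤ n := by omega
        simpa only [h1, h2, if_true] using hynb j h2

theorem spliceGraph_noShortCircuit {g : ℕ} (hadjp : H.Adj (p false) (p true))
    (hH : NoShortReturn H g) : NoShortCircuit (spliceGraph H p f) g := by
  intro m x h1 hm hadj hnb hper
  by_cases hz : ∃ k z, x k = .inr z
  · obtain ⟨k, z, hk⟩ := hz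
    exact spliceGraph_no_circuit_through_inr hadjp hH m (fun j => x (k + j)) h1 hm
      (fun j => hadj (k + j)) (fun j => hnb (k + j)) (fun j => by rw [← add_assoc, hper]) z hk
  · have hy : ∀ k, ∃ a, x k = .inl a := by
      intro k
      rcases hx : x k with a | z
      · exact ⟨a, rfl⟩
      · exact absurd ⟨k, z, hx⟩ hz
    choose y hy using hy
    simp only [hy, spliceGraph_adj_inl_inl] at hadj hnb hper
    refine hH.noShortCircuit.disjointCopies (ι := M) m y h1 hm
      (fun k => ⟨(hadj k).1, (hadj k).2.1⟩) (fun k he => hnb k (congrArg _ he))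
      (fun k => Sum.inl_injective (hper k))

theorem spliceGraph_neighborSet_inr {d : ℕ} (e : M × Bool ≃ Z × Fin d) (z : Z) :
    (spliceGraph H p (fun a => (e a).1)).neighborSet (.inr z) =
      Set.range fun k => .inl ((e.symm (z, k)).1, p (e.symm (z, k)).2) := by
  ext u
  rcases u with ⟨i, v⟩ | w
  · rw [SimpleGraph.mem_neighborSet, spliceGraph_adj_inr_inl]
    constructor
    · rintro ⟨b, hb1, hb2⟩
      dsimp only at hb1 hb2
      refine ⟨(e (i, b)).2, ?_⟩
      have : (z, (e (i, b)).2) = e (i, b) := Prod.ext hb2.symm rfl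
      simp only [this, Equiv.symm_apply_apply, hb1]
    · rintro ⟨k, hk⟩
      have hk := Prod.ext_iff.1 (Sum.inl_injective hk)
      exact ⟨(e.symm (z, k)).2, hk.2.symm, by rw [← hk.1]; simp⟩
  · simp [spliceGraph_not_adj_inr_inr]

theorem spliceGraph_neighborCard {d : ℕ} (hadjp : H.Adj (p false) (p true))
    (hH : NeighborCard H d) (e : M × Bool ≃ Z × Fin d) :
    NeighborCard (spliceGraph H p (fun a => (e a).1)) d := by
  have hp : Function.Injective p := by
    have hne := hadjp.ne
    intro b b' h
    cases b <;> cases b' <;> simp_all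
  classical
  rintro (⟨i, v⟩ | z)
  · refine Eq.trans (Eq.symm ?_) (hH v)
    -- Neighbours in `H` correspond to neighbours after splicing: the partner along the deleted
    -- edge, if any, is replaced by the new vertex.
    refine Set.ncard_congr (fun w _ => if s(v, w) = s(p false, p true) then
      .inr (e (i, if v = p false then false else true)).1 else .inl (i, w)) ?_ ?_ ?_
    · intro w hw
      split_ifs with h1 h2
      · exact ⟨false, h2, rfl⟩
      · refine ⟨true, ?_, rfl⟩
        rcases Sym2.eq_iff.1 h1 with h | h
        · exact absurd h.1 h2
        · exact h.1
      · exact ⟨rfl, hw, h1⟩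
    · intro w w' hw hw' he
      by_cases h1 : s(v, w) = s(p false, p true) <;>
        by_cases h2 : s(v, w') = s(p false, p true)
      · exact Sym2.congr_right.1 (h1.trans h2.symm)
      · simp [h1, h2] at he
      · simp [h1, h2] at he
      · rw [if_neg h1, if_neg h2] at he
        exact (Prod.ext_iff.1 (Sum.inl_injective he)).2
    · rintro (⟨j, w⟩ | z) hu
      · rw [SimpleGraph.mem_neighborSet, spliceGraph_adj_inl_inl] at hu
        obtain ⟨rfl, hw, hne⟩ := hu
        exact ⟨w, hw, if_neg hne⟩
      · obtain ⟨b, rfl, rfl⟩ := hu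
        have hs : s(p b, p !b) = s(p false, p true) := sym2_bool_apply_eq p (by simp)
        refine ⟨p !b, ?_, ?_⟩
        · rw [SimpleGraph.mem_neighborSet, ← SimpleGraph.mem_edgeSet, hs]
          exact hadjp
        · simp only [hs, if_true]
          cases b
          · simp
          · simp [hadjp.ne.symm]
  · rw [spliceGraph_neighborSet_inr, ← Set.image_univ, Set.ncard_image_of_injective]
    · simp
    · intro k k' h
      have h := Prod.ext_iff.1 (Sum.inl_injective h)
      have : e.symm (z, k) = e.symm (z, k') := Prod.ext h.1 (hp h.2)
      simpa using this

/-- Colour the copies by `c`; the new vertices are pairwise non-adjacent with `d` neighbours each,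
so each has a colour to spare. -/
theorem spliceGraph_coloring_nonempty {d : ℕ} (c : H.Coloring (Fin (d + 1)))
    (e : M × Bool ≃ Z × Fin d) :
    Nonempty ((spliceGraph H p (fun a => (e a).1)).Coloring (Fin (d + 1))) := by
  have hfree : ∀ z, ∃ q : Fin (d + 1), ∀ k : Fin d, c (p (e.symm (z, k)).2) ≠ q := by
    intro z
    by_contra! hcon
    have := Fintype.card_le_of_surjective (fun k : Fin d => c (p (e.symm (z, k)).2)) hcon
    simp at this
  choose q hq using hfree
  have hq' : ∀ (a : M × V) (z : Z), (∃ b, a.2 = p b ∧ (e (a.1, b)).1 = z) → c a.2 ≠ q z := by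
    rintro ⟨i, v⟩ z ⟨b, rfl, rfl⟩
    have := hq (e (i, b)).1 (e (i, b)).2
    simpa using this
  refine ⟨SimpleGraph.Coloring.mk (Sum.elim (fun a => c a.2) q) ?_⟩
  rintro (a | z) (b | w) h
  · exact c.valid h.2.1
  · exact hq' a w h
  · exact (hq' b z h).symm
  · exact h.elim

end Splice

/-! ### Rainbow patterns are frozen. -/

section Frozen

variable {V U : Type*} [Fintype U] {H : SimpleGraph V} {K : SimpleGraph U} {k : ℕ}

/-- Changing one vertex preserves a pattern in which every vertex of `H` sees all other colours. -/
theorem eq_of_adj_of_rainbow (φ : H →g K) {τ : H.Coloring (Fin k)}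
    (hτ : ∀ v c, τ v ≠ c → ∃ w, H.Adj v w ∧ τ w = c) {σ σ' : K.Coloring (Fin k)}
    (hadj : (colouringGraph K k 1).Adj σ σ') (hσ : ∀ v, σ (φ v) = τ v) (v : V) :
    σ' (φ v) = τ v := by
  by_contra hne
  -- The new colour of `φ v` is already on a neighbour `φ w`, which cannot change in the same move.
  obtain ⟨w, hvw, hw⟩ := hτ v (σ' (φ v)) (Ne.symm hne)
  have hcard := Finset.card_le_one.1 hadj.2
  have hw' : σ (φ w) = σ' (φ w) := by
    by_contra hww
    exact (φ.map_adj hvw).ne (hcard (φ v) (by simpa [hσ] using Ne.symm hne) (φ w)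
      (by simpa using hww))
  exact σ'.valid (φ.map_adj hvw) (by rw [← hw', hσ, hw])

theorem isFrozen_of_rainbow (φ : H →g K) {τ : H.Coloring (Fin k)}
    (hτ : ∀ v c, τ v ≠ c → ∃ w, H.Adj v w ∧ τ w = c) {σ : K.Coloring (Fin k)}
    (hσ : ∀ v, σ (φ v) = τ v) (v : V) : IsFrozen 1 σ (φ v) := by
  rintro σ' ⟨p⟩
  rw [hσ]
  induction p with
  | nil => exact (hσ v).symm
  | cons hadj _ ih => exact ih (eq_of_adj_of_rainbow φ hτ hadj hσ)

end Frozen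

/-! ### Product structure of colourings and the tail bound. -/

/-- A colouring of a disjoint union of copies is a family of colourings. -/
def copiesColoringEquiv (ι : Type*) {V C : Type*} (H : SimpleGraph V) :
    (disjointCopies ι H).Coloring C ≃ (ι → H.Coloring C) where
  toFun σ i := SimpleGraph.Coloring.mk (fun v => σ (i, v)) fun h => σ.valid ⟨rfl, h⟩
  invFun τ := SimpleGraph.Coloring.mk (fun a => τ a.1 a.2) fun {a b} h => by
    obtain ⟨i, v⟩ := a
    obtain ⟨j, w⟩ := b
    obtain ⟨rfl, h⟩ := h
    exact (τ i).valid h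
  left_inv _ := rfl
  right_inv _ := rfl

/-- Isomorphic graphs have the same colourings. -/
def coloringCongr {V W C : Type*} {G : SimpleGraph V} {H : SimpleGraph W} (φ : G ≃g H) :
    G.Coloring C ≃ H.Coloring C where
  toFun σ := SimpleGraph.Coloring.mk (fun w => σ (φ.symm w))
    fun h => σ.valid (φ.symm.map_adj_iff.2 h)
  invFun τ := SimpleGraph.Coloring.mk (fun v => τ (φ v)) fun h => τ.valid (φ.map_adj_iff.2 h)
  left_inv σ := by ext v; exact congrArg σ (φ.symm_apply_apply v)
  right_inv σ := by ext v; exact congrArg σ (φ.apply_symm_apply v)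

/-- Colourings of a graph isomorphic to the disjoint union of `A` and copies of `H`. -/
def sumCopiesColoringEquiv {ι U V W C : Type*} {K : SimpleGraph U} {A : SimpleGraph W}
    {H : SimpleGraph V} (φ : K ≃g A ⊕g disjointCopies ι H) :
    K.Coloring C ≃ A.Coloring C × (ι → H.Coloring C) :=
  (coloringCongr φ).trans
    (SimpleGraph.Coloring.sumEquiv.trans ((Equiv.refl _).prodCongr (copiesColoringEquiv ι H)))

theorem sumCopiesColoringEquiv_apply {ι U V W C : Type*} {K : SimpleGraph U} {A : SimpleGraph W}
    {H : SimpleGraph V} (φ : K ≃g A ⊕g disjointCopies ι H) (σ : K.Coloring C) (i : ι) (v : V) :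
    (sumCopiesColoringEquiv φ σ).2 i v = σ (φ.symm (.inr (i, v))) := rfl

section Counting

variable {S A T ι : Type*} [Fintype S] [Fintype A] [Fintype T] [Fintype ι]

-- The sum factors over coordinates, each contributing `1 / 2` for `τ₀` and `1` for every other
-- value.
open Classical in
theorem sum_prod_half_eq (τ₀ : T) :
    ∑ t : ι → T, ∏ i, (if t i = τ₀ then (1 / 2 : ℝ) else 1) =
      ((Fintype.card T : ℝ) - 1 / 2) ^ Fintype.card ι := by
  have h := Finset.prod_univ_sum (fun _ : ι => (Finset.univ : Finset T))
    (fun _ t => if t = τ₀ then (1 / 2 : ℝ) else 1)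
  rw [Fintype.piFinset_univ] at h
  rw [← h, Finset.prod_const, Finset.card_univ]
  congr 1
  have h1 : ∀ t : T, (if t = τ₀ then (1 / 2 : ℝ) else 1) = 1 - if t = τ₀ then 1 / 2 else 0 := by
    intro t
    split_ifs <;> norm_num
  rw [Finset.sum_congr rfl fun t _ => h1 t, Finset.sum_sub_distrib]
  simp

open Classical in
/-- Exponential Markov inequality for the number of coordinates equal to a given value. -/
theorem card_few_coordinates_le (Φ : S ≃ A × (ι → T)) (τ₀ : T) (ε : ℝ) :
    (({σ | (({i | (Φ σ).2 i = τ₀} : Finset ι).card : ℝ) < ε * Fintype.card ι} : Finset S).card : ℝ)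
      ≤ ((2 : ℝ) ^ ε * (1 - 1 / (2 * Fintype.card T))) ^ Fintype.card ι * Fintype.card S := by
  set q := Fintype.card ι with hq
  have hT : (0 : ℝ) < Fintype.card T := by exact_mod_cast Fintype.card_pos_iff.2 ⟨τ₀⟩
  have hw : ∀ t : ι → T, ∏ i, (if t i = τ₀ then (1 / 2 : ℝ) else 1) =
      (1 / 2) ^ ({i | t i = τ₀} : Finset ι).card := by
    intro t
    rw [Finset.prod_ite, Finset.prod_const, Finset.prod_const_one, mul_one]
  have hsum : ∑ σ : S, ∏ i, (if (Φ σ).2 i = τ₀ then (1 / 2 : ℝ) else 1) =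
      Fintype.card A * ((Fintype.card T : ℝ) - 1 / 2) ^ q := by
    rw [Equiv.sum_comp Φ (fun x => ∏ i, (if x.2 i = τ₀ then (1 / 2 : ℝ) else 1)),
      Fintype.sum_prod_type]
    simp only [sum_prod_half_eq]
    simp [hq]
  have hS : (Fintype.card S : ℝ) = Fintype.card A * (Fintype.card T : ℝ) ^ q := by
    rw [Fintype.card_congr Φ]
    simp [hq]
  -- With `N` coordinates equal to `τ₀`, the right side is `2 ^ (ε * q - N)`.
  have hterm : ∀ σ ∈ ({σ | (({i | (Φ σ).2 i = τ₀} : Finset ι).card : ℝ) < ε * q} : Finset S),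
      (1 : ℝ) ≤ ((2 : ℝ) ^ ε) ^ q * ∏ i, (if (Φ σ).2 i = τ₀ then (1 / 2 : ℝ) else 1) := by
    intro σ hσ
    have hσ := (Finset.mem_filter.1 hσ).2
    rw [hw, ← Real.rpow_mul_natCast (by norm_num), one_div, inv_pow, ← div_eq_mul_inv,
      one_le_div (by positivity), ← Real.rpow_natCast]
    exact Real.rpow_le_rpow_of_exponent_le (by norm_num) hσ.le
  calc (({σ | (({i | (Φ σ).2 i = τ₀} : Finset ι).card : ℝ) < ε * q} : Finset S).card : ℝ)
      = ∑ σ ∈ ({σ | (({i | (Φ σ).2 i = τ₀} : Finset ι).card : ℝ) < ε * q} : Finset S), (1 : ℝ) := by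
        simp
    _ ≤ ∑ σ ∈ ({σ | (({i | (Φ σ).2 i = τ₀} : Finset ι).card : ℝ) < ε * q} : Finset S),
        ((2 : ℝ) ^ ε) ^ q * ∏ i, (if (Φ σ).2 i = τ₀ then (1 / 2 : ℝ) else 1) :=
        Finset.sum_le_sum hterm
    _ ≤ ∑ σ : S, ((2 : ℝ) ^ ε) ^ q * ∏ i, (if (Φ σ).2 i = τ₀ then (1 / 2 : ℝ) else 1) :=
        Finset.sum_le_sum_of_subset_of_nonneg (Finset.subset_univ _) fun σ _ _ =>
          mul_nonneg (by positivity) (Finset.prod_nonneg fun i _ => by split_ifs <;> norm_num)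
    _ = ((2 : ℝ) ^ ε * (1 - 1 / (2 * Fintype.card T))) ^ q * Fintype.card S := by
        rw [← Finset.mul_sum, hsum, hS]
        have : (Fintype.card T : ℝ) - 1 / 2 = (1 - 1 / (2 * Fintype.card T)) * Fintype.card T := by
          field_simp
        rw [this, mul_pow, mul_pow]
        ring

theorem one_sub_le_uniformOn [MeasurableSpace S] [MeasurableSingletonClass S] [Nonempty S]
    {s : Set S} {B : Finset S} {r : ℝ} (hB : (B.card : ℝ) ≤ r * Fintype.card S)
    (hs : ∀ σ, σ ∉ B → σ ∈ s) :
    1 - ENNReal.ofReal r ≤ ProbabilityTheory.uniformOn Set.univ s := by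
  have hpos : (0 : ℝ) < Fintype.card S := by exact_mod_cast Fintype.card_pos
  have : MeasureTheory.IsProbabilityMeasure
      (ProbabilityTheory.uniformOn (Set.univ : Set S)) :=
    ProbabilityTheory.isProbabilityMeasure_uniformOn Set.finite_univ Set.univ_nonempty
  have hBr : ProbabilityTheory.uniformOn (Set.univ : Set S) (B : Set S) ≤ ENNReal.ofReal r := by
    rw [ProbabilityTheory.uniformOn_univ, MeasureTheory.Measure.count_apply_finset]
    refine ENNReal.div_le_of_le_mul ?_
    rw [← ENNReal.ofReal_natCast, ← ENNReal.ofReal_natCast, ← ENNReal.ofReal_mul' hpos.le]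
    exact ENNReal.ofReal_le_ofReal hB
  rw [tsub_le_iff_right]
  calc (1 : ENNReal) = ProbabilityTheory.uniformOn (Set.univ : Set S) Set.univ :=
        MeasureTheory.measure_univ.symm
    _ ≤ ProbabilityTheory.uniformOn Set.univ (s ∪ B) :=
        MeasureTheory.measure_mono fun σ _ => by
          by_cases h : σ ∈ B
          · exact Or.inr h
          · exact Or.inl (hs σ h)
    _ ≤ _ := (MeasureTheory.measure_union_le _ _).trans (by gcongr)

end Counting

/-- In a uniformly random colouring of a disjoint union of `A` with copies of `H`, a positive
proportion of the copies carries a given rainbow colouring, with high probability. -/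
theorem uniformColouring_numFrozen_ge {ι U V W : Type*} [Fintype ι] [Fintype U] [Fintype V]
    [Finite W] {k : ℕ} {K : SimpleGraph U} {A : SimpleGraph W} {H : SimpleGraph V}
    (φ : K ≃g A ⊕g disjointCopies ι H) (hA : Nonempty (A.Coloring (Fin k)))
    {τ : H.Coloring (Fin k)} (hτ : ∀ v c, τ v ≠ c → ∃ w, H.Adj v w ∧ τ w = c) (ε : ℝ) :
    1 - ENNReal.ofReal
        (((2 : ℝ) ^ ε * (1 - 1 / (2 * Nat.card (H.Coloring (Fin k))))) ^ Fintype.card ι) ≤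
      uniformColouring K k
        {σ | ε * (Fintype.card ι * Fintype.card V) ≤ (numFrozen σ : ℝ)} := by
  classical
  have : Finite (K.Coloring (Fin k)) := DFunLike.finite _
  have : Finite (A.Coloring (Fin k)) := DFunLike.finite _
  have : Finite (H.Coloring (Fin k)) := DFunLike.finite _
  have := Fintype.ofFinite (K.Coloring (Fin k))
  have := Fintype.ofFinite (A.Coloring (Fin k))
  have := Fintype.ofFinite (H.Coloring (Fin k))
  have : MeasurableSingletonClass (K.Coloring (Fin k)) := ⟨fun _ => trivial⟩
  set Φ := sumCopiesColoringEquiv (C := Fin k) φ with hΦ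
  -- Without a colouring of `A` the uniform law would not be a probability measure.
  have : Nonempty (K.Coloring (Fin k)) := ⟨Φ.symm (hA.some, fun _ => τ)⟩
  rw [Nat.card_eq_fintype_card]
  refine one_sub_le_uniformOn (card_few_coordinates_le Φ τ ε) fun σ hσ => ?_
  have hσ : ε * Fintype.card ι ≤ (({i | (Φ σ).2 i = τ} : Finset ι).card : ℝ) := by
    simp only [Finset.mem_filter, Finset.mem_univ, true_and, not_lt] at hσ
    exact hσ.trans (le_of_eq (by congr!))
  have hsub : (fun a : ι × V => φ.symm (.inr a)) ''
      ((({i | (Φ σ).2 i = τ} : Finset ι) ×ˢ (Finset.univ : Finset V) : Finset (ι × V)) :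
        Set (ι × V)) ⊆ {v | IsFrozen 1 σ v} := by
    rintro _ ⟨⟨i, v⟩, hi, rfl⟩
    have hi : (Φ σ).2 i = τ := by simpa using hi
    let ψ : H →g K :=
      ⟨fun v => φ.symm (.inr (i, v)), fun h => φ.symm.map_adj_iff.2
        (SimpleGraph.sum_adj_inr.2 ⟨rfl, h⟩)⟩
    refine isFrozen_of_rainbow ψ hτ (fun v => ?_) v
    rw [← hi, hΦ, sumCopiesColoringEquiv_apply]
    rfl
  have hcard := Set.ncard_le_ncard hsub (Set.toFinite _)
  rw [Set.ncard_image_of_injective _ fun _ _ h => Sum.inr_injective (φ.symm.injective h),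
    Set.ncard_coe_finset, Finset.card_product, Finset.card_univ] at hcard
  calc ε * (Fintype.card ι * Fintype.card V) = ε * Fintype.card ι * Fintype.card V := by ring
    _ ≤ (({i | (Φ σ).2 i = τ} : Finset ι).card : ℝ) * Fintype.card V := by gcongr
    _ ≤ (numFrozen σ : ℝ) := by exact_mod_cast hcard

/-! ### Assembling the graphs and passing to the limit. -/

/-- For all large `n` with `d * n` even, `n` vertices can be split into disjoint copies of a
`d`-regular graph `H` and a bounded remainder that also supports a `d`-regular graph. -/
theorem exists_iso_sum_disjointCopies {V : Type*} [Fintype V] {H : SimpleGraph V} {d g : ℕ}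
    (hreg : NeighborCard H d) (hret : NoShortReturn H g) (τ : H.Coloring (Fin (d + 1)))
    (p : Bool → V) (hp : H.Adj (p false) (p true)) (hpar : Odd d → Even (Fintype.card V))
    {n : ℕ} (hn : 2 * (Fintype.card V * Fintype.card V * d + Fintype.card V) ≤ n)
    (heven : Even (d * n)) :
    ∃ (m r q : ℕ) (A : SimpleGraph ((Fin m × V) ⊕ Fin r)) (K : SimpleGraph (Fin n)),
      Nonempty (K ≃g A ⊕g disjointCopies (Fin q) H) ∧ Nonempty (A.Coloring (Fin (d + 1))) ∧
      NeighborCard K d ∧ NoShortCircuit K g ∧ n ≤ 2 * (q * Fintype.card V) := by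
  set h := Fintype.card V with hh
  have hpos : 0 < h := Fintype.card_pos_iff.2 ⟨p false⟩
  set r := n % h with hr
  have hrlt : r < h := Nat.mod_lt _ hpos
  have hnr : h * (n / h) + r = n := Nat.div_add_mod n h
  have hrd : Even (r * d) := by
    rcases Nat.even_or_odd d with hd | hd
    · exact hd.mul_left r
    · have hn2 : Even n := (Nat.even_mul.1 heven).resolve_left (by simpa using hd)
      have h2 : Even (h * (n / h) + r) := by rwa [hnr]
      exact ((Nat.even_add.1 h2).1 ((hpar hd).mul_right _)).mul_right d
  -- Splicing `m` copies yields `2 * m` loose ends, which must fill the `r * d` slots at the `r` new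
  -- vertices.
  obtain ⟨m, hm⟩ := hrd
  have hmle : m ≤ h * d := by
    have : r * d ≤ h * d := Nat.mul_le_mul_right d hrlt.le
    omega
  have hmh : m * h ≤ h * h * d := by
    calc m * h ≤ h * d * h := Nat.mul_le_mul_right h hmle
      _ = h * h * d := by ring
  have hmq : m ≤ n / h := by
    rw [Nat.le_div_iff_mul_le hpos]
    omega
  obtain ⟨q, hq⟩ := Nat.exists_eq_add_of_le hmq
  have hcount : n = m * h + r + q * h := by
    rw [← hnr, hq]
    ring
  have e : Fin m × Bool ≃ Fin r × Fin d := Fintype.equivOfCardEq (by simp; omega)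
  have eqv : Fin n ≃ ((Fin m × V) ⊕ Fin r) ⊕ (Fin q × V) :=
    Fintype.equivOfCardEq (by simpa using hcount)
  let A := spliceGraph H p (fun a => (e a).1)
  let φ := SimpleGraph.Iso.comap eqv (A ⊕g disjointCopies (Fin q) H)
  exact ⟨m, r, q, A, (A ⊕g disjointCopies (Fin q) H).comap eqv, ⟨φ⟩,
    spliceGraph_coloring_nonempty τ e,
    ((spliceGraph_neighborCard hp hreg e).sum hreg.disjointCopies).of_iso φ,
    ((spliceGraph_noShortCircuit hp hret).sum hret.noShortCircuit.disjointCopies).of_iso φ,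
    -- The remainder has `m * h + r ≤ h * h * d + h` vertices, at most half of `n`; this is where
    -- the threshold on `n` comes from.
    by omega⟩

theorem exists_pos_two_rpow_mul_lt_one {a : ℝ} (ha : a < 1) :
    ∃ ε : ℝ, 0 < ε ∧ (2 : ℝ) ^ ε * a < 1 := by
  have hcont : Continuous fun ε : ℝ => (2 : ℝ) ^ ε * a :=
    (Real.continuous_const_rpow (by norm_num)).mul continuous_const
  have h0 : ∀ᶠ ε in nhds (0 : ℝ), (2 : ℝ) ^ ε * a < 1 :=
    hcont.continuousAt.eventually_lt_const (by simpa using ha)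
  obtain ⟨ε, h1, h2⟩ := ((h0.filter_mono nhdsWithin_le_nhds).and
    (self_mem_nhdsWithin (s := Set.Ioi (0 : ℝ)))).exists
  exact ⟨ε, h2, h1⟩

theorem mainTheorem11 (g : ℕ) (hg : 3 ≤ g) (d : ℕ) (hd : 3 ≤ d) :
    ∃ c C : ℝ, 0 < c ∧ 0 < C ∧ ∃ G : (n : ℕ) → SimpleGraph (Fin n),
      (∃ N : ℕ, ∀ n : ℕ, N ≤ n → Even (d * n) →
        IsRegularGraph (G n) d ∧ (g : ℕ∞) ≤ (G n).egirth) ∧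
      Filter.Tendsto
        (fun n : ℕ => uniformColouring (G n) (d + 1)
          {σ | c * (n : ℝ) ≤ (numFrozen σ : ℝ) ∧ (numFrozen σ : ℝ) ≤ C * (n : ℝ)})
        (Filter.atTop ⊓ Filter.principal {n : ℕ | Even (d * n)}) (nhds 1) := by
  classical
  have := Fintype.ofFinite (LiftVertex (Fin (d + 1)) g)
  set H := completeLift (Fin (d + 1)) g
  set τ : H.Coloring (Fin (d + 1)) := baseColoring (Fin (d + 1)) g
  set h := Fintype.card (LiftVertex (Fin (d + 1)) g) with hh
  have hpos : 0 < h := Fintype.card_pos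
  have hτ : ∀ v c, τ v ≠ c → ∃ w, H.Adj v w ∧ τ w = c :=
    fun v c hc => completeLift_exists_neighbor v hc
  have hpar : Odd d → Even h := by
    intro hodd
    rw [hh, ← Nat.card_eq_fintype_card, Nat.card_prod, Nat.card_eq_fintype_card, Fintype.card_fin]
    exact hodd.add_one.mul_right _
  obtain ⟨u, w, huw⟩ : ∃ u w, H.Adj u w := by
    obtain ⟨w, hw, -⟩ := completeLift_exists_neighbor (L := g) ((0 : Fin (d + 1)), 1)
      (c := Fin.last d) (by simp [Fin.ext_iff]; omega)
    exact ⟨_, w, hw⟩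
  have : Finite (H.Coloring (Fin (d + 1))) := DFunLike.finite _
  have hcol : (1 : ℝ) ≤ Nat.card (H.Coloring (Fin (d + 1))) := by
    have : Nonempty (H.Coloring (Fin (d + 1))) := ⟨τ⟩
    exact_mod_cast Nat.one_le_iff_ne_zero.2 Nat.card_pos.ne'
  set a : ℝ := 1 - 1 / (2 * Nat.card (H.Coloring (Fin (d + 1)))) with ha
  have ha0 : 0 ≤ a := by
    rw [ha, sub_nonneg, div_le_one (by linarith)]
    linarith
  have ha1 : a < 1 := by
    rw [ha, sub_lt_self_iff]
    positivity
  obtain ⟨ε, hε, hρ⟩ := exists_pos_two_rpow_mul_lt_one ha1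
  set ρ := (2 : ℝ) ^ ε * a
  have hρ0 : 0 ≤ ρ := by positivity
  have key : ∀ n : ℕ, ∃ K : SimpleGraph (Fin n), 2 * (h * h * d + h) ≤ n → Even (d * n) →
      IsRegularGraph K d ∧ (g : ℕ∞) ≤ K.egirth ∧
      1 - ENNReal.ofReal (ρ ^ (n / (2 * h))) ≤ uniformColouring K (d + 1)
        {σ | ε / 2 * (n : ℝ) ≤ (numFrozen σ : ℝ) ∧ (numFrozen σ : ℝ) ≤ 1 * (n : ℝ)} := by
    intro n
    by_cases hn : 2 * (h * h * d + h) ≤ n ∧ Even (d * n)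
    · obtain ⟨m, r, q, A, K, ⟨φ⟩, hA, hK1, hK2, hq⟩ :=
        exists_iso_sum_disjointCopies (completeLift_neighborCard d g)
          (completeLift_noShortReturn (Fin (d + 1)) g) τ (fun b => if b then w else u) huw hpar
          hn.1 hn.2
      refine ⟨K, fun _ _ => ⟨hK1.isRegularGraph, hK2.le_egirth, ?_⟩⟩
      have hbound := uniformColouring_numFrozen_ge φ hA hτ ε
      rw [Fintype.card_fin] at hbound
      refine le_trans ?_ (hbound.trans (MeasureTheory.measure_mono fun σ hσ => ⟨?_, ?_⟩))
      · refine tsub_le_tsub_left (ENNReal.ofReal_le_ofReal ?_) 1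
        -- The intact copies cover at least half of the vertices, so `q` is at least `n / (2 * h)`.
        refine pow_le_pow_of_le_one hρ0 hρ.le (Nat.div_le_of_le_mul ?_)
        calc n ≤ 2 * (q * h) := hq
          _ = 2 * h * q := by ring
      · refine le_trans ?_ hσ
        have hq' : (n : ℝ) ≤ 2 * (q * h) := by exact_mod_cast hq
        calc ε / 2 * (n : ℝ) ≤ ε / 2 * (2 * (q * h)) := by gcongr
          _ = ε * (q * h) := by ring
      · have : numFrozen σ ≤ n := by
          simpa [numFrozen] using Set.ncard_le_card {v : Fin n | IsFrozen 1 σ v}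
        rw [one_mul]
        exact_mod_cast this
    · exact ⟨⊥, fun h1 h2 => absurd ⟨h1, h2⟩ hn⟩
  choose G hG using key
  refine ⟨ε / 2, 1, by positivity, one_pos, G, ⟨2 * (h * h * d + h), fun n h1 h2 =>
    ⟨(hG n h1 h2).1, (hG n h1 h2).2.1⟩⟩, ?_⟩
  have hlim : Filter.Tendsto (fun n : ℕ => 1 - ENNReal.ofReal (ρ ^ (n / (2 * h))))
      (Filter.atTop ⊓ Filter.principal {n : ℕ | Even (d * n)}) (nhds 1) := by
    have h1 : Filter.Tendsto (fun n : ℕ => ρ ^ (n / (2 * h))) Filter.atTop (nhds 0) :=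
      (tendsto_pow_atTop_nhds_zero_of_lt_one hρ0 hρ).comp
        (Nat.tendsto_div_const_atTop (by omega))
    have h2 := ENNReal.Tendsto.sub (tendsto_const_nhds (x := (1 : ENNReal)))
      (ENNReal.tendsto_ofReal h1) (Or.inl ENNReal.one_ne_top)
    rw [ENNReal.ofReal_zero, tsub_zero] at h2
    exact h2.mono_left inf_le_left
  have hle : ∀ n, uniformColouring (G n) (d + 1) {σ | ε / 2 * (n : ℝ) ≤ (numFrozen σ : ℝ) ∧
      (numFrozen σ : ℝ) ≤ 1 * (n : ℝ)} ≤ 1 := fun n => by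
    unfold uniformColouring ProbabilityTheory.uniformOn
    exact MeasureTheory.prob_le_one
  refine tendsto_of_tendsto_of_tendsto_of_le_of_le' hlim tendsto_const_nhds ?_
    (Filter.Eventually.of_forall hle)
  rw [Filter.eventually_inf_principal]
  filter_upwards [Filter.eventually_ge_atTop (2 * (h * h * d + h))] with n h1 h2
  exact (hG n h1 h2).2.2
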